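/- Let $N\ge 1$ and let $W(\mathbf x)=-\sum_{1\le j<l\le N}\log|e^{ix_l}-e^{ix_j}|$. Dyson Brownian motion from the identity on $U(N)$ is described by the joint law $p_t$ ($t\ge 0$) of its eigenvalue angles $\mathbf x=(x_1,\dots,x_N)\in(-\pi,\pi]^N$: for $t>0$ this is a probability density function on the torus, with $\partial W/\partial x_j$ integrable against it, which solves (in the weak sense, tested against smooth functions that are $2\pi$-periodic in each angle) the Fokker–Planck equation $$\frac{\partial p_t}{\partial t}=\frac1N\sum_{j=1}^N\frac{\partial}{\partial x_j}\Big(\frac{\partial W}{\partial x_j}+\frac12\frac{\partial}{\partial x_j}\Big)p_t ,$$ with initial condition $p_t|_{t=0}=\prod_{l=1}^N\delta(x_l)$, attained weakly as $t\to0^+$. Let $\rho_{(1),N}(x;t)=\big\langle\sum_{j=1}^N\delta(x-x_j)\big\rangle$ be the eigenvalue density, where $\langle\cdot\rangle$ is the average over $p_t$, and let $$m_k^{(N)}(t)=\frac1N\int_{-\pi}^{\pi}\rho_{(1),N}(x;t)\,e^{-ikx}\,dx\qquad(k\in\mathbb Z)$$ be its moments (Fourier coefficients). Then, with $q=e^{-t/2N}$,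 for every $t\ge0$ and every $k\in\mathbb Z$, $$m_k^{(N)}(t)=q^{k(N+k-1)}\,{}_2F_1(1-N,1-k;2;1-q^{-2k})=q^{k^2-k(N-1)}\,{}_2F_1(1-N,1+k;2;1-q^{2k}),$$ and, in terms of the Jacobi polynomials $P_n^{(a,b)}$, $$m_k^{(N)}(t)=\frac1N\,q^{k^2-k(N-1)}P_{N-1}^{(1,k-N)}(2q^{2k}-1)=\frac{(-1)^{N-1}}N\,q^{k^2-k(N-1)}P_{N-1}^{(k-N,1)}(1-2q^{2k}).$$ Moreover, for every integer $k\ge1$, $$m_k^{(N)}(t)=q^{k^2+k(N-1)}\,\frac{(N-1+k)!}{k!\,N!}\,{}_2F_1\big(1-N,1-k;-(k-1+N);q^{-2k}\big).$$ Here ${}_2F_1(a,b;c;z)=\sum_{n\ge0}\frac{(a)_n(b)_n}{n!\,(c)_n}z^n$, which terminates in all these cases, and $P_n^{(a,b)}(x)=\sum_{s=0}^n\binom{n+a}{n-s}\binom{n+b}{s}\big(\frac{x-1}2\big)^s\big(\frac{x+1}2\big)^{n-s}$ with generalized binomial coefficients. -/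

import Mathlib

open MeasureTheory Filter Topology
open scoped ContDiff

namespace DysonU

/-- The partial derivative `∂f/∂x_j` of a function of the angles `x = (x_1, …, x_N)`. -/
noncomputable def pderiv {N : ℕ} {E : Type*} [NormedAddCommGroup E] [NormedSpace ℝ E]
    (j : Fin N) (f : (Fin N → ℝ) → E) (x : Fin N → ℝ) : E :=
  fderiv ℝ f x (Pi.single j 1)

/-- The cube `(-π, π]^N` in which the vector of eigenvalue angles takes its values. -/
def angleCube (N : ℕ) : Set (Fin N → ℝ) :=
  {x | ∀ j, x j ∈ Set.Ioc (-Real.pi) Real.pi}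

/-- The potential `W(x) = - ∑_{j < k} log |e^{i x_k} - e^{i x_j}|`. -/
noncomputable def potentialW (N : ℕ) (x : Fin N → ℝ) : ℝ :=
  - ∑ j : Fin N, ∑ k ∈ Finset.Ioi j,
      Real.log ‖Complex.exp (Complex.I * (x k : ℂ)) - Complex.exp (Complex.I * (x j : ℂ))‖

/-- The formal adjoint of the Fokker-Planck operator
`𝓛 p = ∑_j ∂_j ((∂_j W) p + (1/β) ∂_j p)` at `β = 2`, that is,
`𝓛* φ = ∑_j (- (∂_j W) ∂_j φ + (1/2) ∂_j² φ)`. -/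
noncomputable def adjointFP (N : ℕ) (φ : (Fin N → ℝ) → ℂ) (x : Fin N → ℝ) : ℂ :=
  ∑ j : Fin N, (-((pderiv j (potentialW N) x : ℝ) : ℂ) * pderiv j φ x
    + (1 / 2 : ℂ) * pderiv j (pderiv j φ) x)

/-- Test functions on the torus: smooth functions of the angles which are `2π`-periodic
in each angle. -/
structure IsTestFunction {N : ℕ} (φ : (Fin N → ℝ) → ℂ) : Prop where
  smooth : ContDiff ℝ ∞ φ
  periodic : ∀ (x : Fin N → ℝ) (j : Fin N), φ (x + Pi.single j (2 * Real.pi)) = φ x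

/-- `μ t`, `t ≥ 0`, is the joint law of the eigenvalue angles, at time `t`, of Dyson Brownian
motion on `U(N)` whose initial eigenvalues are `e^{i x⁰_1}, …, e^{i x⁰_N}`. With the scaling
`τ / γ = t / N` of time, the Fokker-Planck equation `γ ∂p/∂τ = 𝓛 p` reads `∂p/∂t = (1/N) 𝓛 p`;
it is imposed in the weak form on the torus, for `t > 0`, together with the initial condition
`p = ∏_l δ(x_l - x⁰_l)` at `t = 0`. -/
structure IsDysonBM (N : ℕ) (x₀ : Fin N → ℝ) (μ : ℝ → Measure (Fin N → ℝ)) : Prop where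
  /-- each law is a probability measure -/
  isProb : ∀ t, 0 ≤ t → IsProbabilityMeasure (μ t)
  /-- it is carried by `(-π, π]^N` -/
  mem_cube : ∀ t, 0 ≤ t → ∀ᵐ x ∂(μ t), x ∈ angleCube N
  /-- for positive times the angles have a joint probability density function -/
  hasPDF : ∀ t, 0 < t → μ t ≪ volume
  /-- the drift is integrable, so that the weak equation is meaningful -/
  integrable_drift : ∀ t, 0 < t → ∀ j : Fin N, Integrable (pderiv j (potentialW N)) (μ t)
  /-- the Fokker-Planck equation, tested against smooth functions on the torus -/
  weak_eq : ∀ φ : (Fin N → ℝ) → ℂ, IsTestFunction φ → ∀ t, 0 < t →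
    HasDerivAt (fun s : ℝ => ∫ x, φ x ∂(μ s)) ((1 / (N : ℂ)) * ∫ x, adjointFP N φ x ∂(μ t)) t
  /-- the initial law is the point mass at `x₀` -/
  init : μ 0 = Measure.dirac x₀
  /-- the initial law is attained -/
  init_limit : ∀ φ : (Fin N → ℝ) → ℂ, IsTestFunction φ →
    Tendsto (fun s : ℝ => ∫ x, φ x ∂(μ s)) (𝓝[>] 0) (𝓝 (φ x₀))

/-- Dyson Brownian motion started at the identity matrix: all initial angles are `0`. -/
def IsDysonBMFromIdentity (N : ℕ) (μ : ℝ → Measure (Fin N → ℝ)) : Prop :=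
  IsDysonBM N 0 μ

/-- The eigenvalue density `ρ_{(1),N}(x) dx = ⟨∑_j δ(x - x_j)⟩` of a joint law of angles, as a
measure on the line; its total mass is `N` if `ν` is a probability measure. -/
noncomputable def eigenvalueDensity {N : ℕ} (ν : Measure (Fin N → ℝ)) : Measure ℝ :=
  ∑ j : Fin N, ν.map (fun x => x j)

/-- The density moment `m_k^{(N)} = (1/N) ∫_{-π}^{π} ρ_{(1),N}(x) e^{-ikx} dx`. -/
noncomputable def densityMoment {N : ℕ} (ν : Measure (Fin N → ℝ)) (k : ℤ) : ℂ :=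
  (1 / (N : ℂ)) * ∫ x in Set.Ioc (-Real.pi) Real.pi,
    Complex.exp (-Complex.I * (k : ℂ) * (x : ℂ)) ∂(eigenvalueDensity ν)

/-- The Jacobi polynomial
`P_n^{(a,b)}(x) = ∑_s (n+a choose n-s) (n+b choose s) ((x-1)/2)^s ((x+1)/2)^{n-s}`,
with generalized binomial coefficients; this is valid for all real parameters. -/
noncomputable def jacobiP (n : ℕ) (a b x : ℝ) : ℝ :=
  ∑ s ∈ Finset.range (n + 1), Ring.choose ((n : ℝ) + a) (n - s) * Ring.choose ((n : ℝ) + b) s *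
    ((x - 1) / 2) ^ s * ((x + 1) / 2) ^ (n - s)

end DysonU

namespace DysonU

/-! ### Partial derivatives -/

section Pderiv

variable {N : ℕ} {E : Type*} [NormedAddCommGroup E] [NormedSpace ℝ E]

/-! The power sum `∑ l, e^{-ikx_l}` splits into `N` eigenfunctions of the adjoint Fokker–Planck
operator, so its average is a sum of `N` exponentials in `t`.

Up to a constant, `e^{-W}` is locally, off the coincidences of angles, the Vandermonde alternant `A`
with centred exponents `rho` (`alternant_rho`, `pderiv_potentialW_mul`). If `A F` equals an
alternant with exponents `κ`, the product rule gives `A 𝓛*F = (Δ(A F) - F ΔA) / 2`. Alternants are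
eigenfunctions of the Laplacian, so `F` has eigenvalue `(|rho|² - |κ|²) / 2`
(`adjointFP_eq_of_mul_alternant`).

For `k ≥ 0` the summands are the diagonal entries of the `k`-th power of the companion matrix of the
points `e^{-ix_l}`. The trace is the power sum, and by Cramer's rule the `p`-th entry is the
quotient of alternants with `κ = rho + k e_p` (for `k ≥ 1`, zero or a signed hook Schur function).
Being polynomial in the symmetric functions of the points, it is smooth also where eigenvalues
coincide.

Each average is then its initial value times an exponential (`IsDysonBM.integral_eq`). The value at
the identity is the Weyl-type product of `value_zero_of_mul_alternant`, here two binomial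
coefficients (`prod_shiftedRho`). Summing over `p` yields `momentPoly`; conjugation symmetry covers
`k < 0`. All the stated forms are rewritings of this polynomial by binomial identities. -/

lemma pderiv_eq_of_hasFDerivAt {j : Fin N} {f : (Fin N → ℝ) → E} {x : Fin N → ℝ}
    {f' : (Fin N → ℝ) →L[ℝ] E} (h : HasFDerivAt f f' x) :
    pderiv j f x = f' (Pi.single j 1) := by
  rw [pderiv, h.fderiv]

lemma pderiv_congr {j : Fin N} {f g : (Fin N → ℝ) → E} {x : Fin N → ℝ} (h : f =ᶠ[𝓝 x] g) :
    pderiv j f x = pderiv j g x := by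
  rw [pderiv, pderiv, h.fderiv_eq]

lemma pderiv_mul {j : Fin N} {f g : (Fin N → ℝ) → ℂ} {x : Fin N → ℝ}
    (hf : DifferentiableAt ℝ f x) (hg : DifferentiableAt ℝ g x) :
    pderiv j (fun y => f y * g y) x = pderiv j f x * g x + f x * pderiv j g x := by
  rw [pderiv_eq_of_hasFDerivAt (hf.hasFDerivAt.fun_mul hg.hasFDerivAt)]
  simp [pderiv]
  ring

lemma pderiv_add {j : Fin N} {f g : (Fin N → ℝ) → ℂ} {x : Fin N → ℝ}
    (hf : DifferentiableAt ℝ f x) (hg : DifferentiableAt ℝ g x) :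
    pderiv j (fun y => f y + g y) x = pderiv j f x + pderiv j g x := by
  rw [pderiv_eq_of_hasFDerivAt (hf.hasFDerivAt.fun_add hg.hasFDerivAt)]
  simp [pderiv]

lemma contDiff_pderiv {j : Fin N} {f : (Fin N → ℝ) → E} (hf : ContDiff ℝ ∞ f) :
    ContDiff ℝ ∞ (pderiv j f) :=
  ((hf.fderiv_right (m := ∞) le_rfl).clm_apply contDiff_const : _)

end Pderiv

/-! ### Exponential sums -/

/-- The exponential sum `∑ σ, a σ * exp (-i ∑ l, c σ l * x l)`. -/
noncomputable def expSum {N : ℕ} {ι : Type*} [Fintype ι] (a : ι → ℂ) (c : ι → Fin N → ℝ)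
    (x : Fin N → ℝ) : ℂ :=
  ∑ σ, a σ * Complex.exp (-Complex.I * ((∑ l, c σ l * x l : ℝ) : ℂ))

section ExpSum

variable {N : ℕ} {ι : Type*} [Fintype ι]

lemma contDiff_expSum (a : ι → ℂ) (c : ι → Fin N → ℝ) : ContDiff ℝ ∞ (expSum a c) := by
  unfold expSum
  refine ContDiff.sum fun σ _ => contDiff_const.mul (ContDiff.cexp (contDiff_const.mul ?_))
  have : ContDiff ℝ ∞ fun x : Fin N → ℝ => ∑ l, c σ l * x l :=
    ContDiff.sum fun l _ => contDiff_const.mul (contDiff_apply ℝ ℝ l)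
  exact Complex.ofRealCLM.contDiff.comp this

lemma pderiv_expSum (a : ι → ℂ) (c : ι → Fin N → ℝ) (j : Fin N) :
    pderiv j (expSum a c) = expSum (fun σ => a σ * (-Complex.I * c σ j)) c := by
  funext x
  have h : HasFDerivAt (expSum a c) (∑ σ, a σ •
      (Complex.exp (-Complex.I * ((∑ l, c σ l * x l : ℝ) : ℂ)) •
      (-Complex.I) • (Complex.ofRealCLM.comp
        (∑ l, c σ l • ContinuousLinearMap.proj (R := ℝ) (φ := fun _ : Fin N => ℝ) l)))) x := by
    unfold expSum
    refine HasFDerivAt.fun_sum fun σ _ => HasFDerivAt.const_mul (HasFDerivAt.cexp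
      (HasFDerivAt.const_mul ?_ _)) _
    have : HasFDerivAt (fun x : Fin N → ℝ => ∑ l, c σ l * x l)
        (∑ l, c σ l • ContinuousLinearMap.proj (R := ℝ) (φ := fun _ : Fin N => ℝ) l) x :=
      HasFDerivAt.fun_sum fun l _ => HasFDerivAt.const_mul
        (ContinuousLinearMap.proj (R := ℝ) (φ := fun _ : Fin N => ℝ) l).hasFDerivAt _
    exact Complex.ofRealCLM.hasFDerivAt.comp x this
  rw [pderiv_eq_of_hasFDerivAt h]
  simp only [expSum, sum_apply, smul_apply,
    ContinuousLinearMap.comp_apply, ContinuousLinearMap.proj_apply, smul_eq_mul,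
    Pi.single_apply, mul_ite, mul_one, mul_zero, Finset.sum_ite_eq', Finset.mem_univ, if_true,
    Complex.ofRealCLM_apply]
  exact Finset.sum_congr rfl fun σ _ => by ring

lemma laplacian_expSum (a : ι → ℂ) (c : ι → Fin N → ℝ) (e : ℝ) (he : ∀ σ, ∑ j, c σ j ^ 2 = e)
    (x : Fin N → ℝ) :
    ∑ j, pderiv j (pderiv j (expSum a c)) x = -e * expSum a c x := by
  simp only [pderiv_expSum]
  unfold expSum
  rw [Finset.sum_comm, Finset.mul_sum]
  refine Finset.sum_congr rfl fun σ _ => ?_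
  generalize Complex.exp _ = w
  rw [← he σ, Complex.ofReal_sum, ← Finset.sum_neg_distrib, Finset.sum_mul]
  refine Finset.sum_congr rfl fun j _ => ?_
  push_cast
  linear_combination (a σ * (c σ j : ℂ) ^ 2 * w) * Complex.I_sq

end ExpSum

/-! ### Alternants -/

/-- The alternant `det (exp (-i κ_m x_l))`. -/
noncomputable def alternant {N : ℕ} (κ : Fin N → ℝ) (x : Fin N → ℝ) : ℂ :=
  (Matrix.of fun l m : Fin N => Complex.exp (-Complex.I * ((κ m * x l : ℝ) : ℂ))).det

section Alternant

variable {N : ℕ} (κ : Fin N → ℝ)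

/-- Leibniz expansion. The frequency vectors are the permutations of `κ`, all of the same norm,
which is why an alternant is a Laplace eigenfunction. -/
lemma alternant_eq_expSum :
    alternant κ = expSum (fun σ : Equiv.Perm (Fin N) => ((Equiv.Perm.sign σ : ℤ) : ℂ))
      (fun σ l => κ (σ⁻¹ l)) := by
  funext x
  rw [alternant, Matrix.det_apply', expSum]
  refine Finset.sum_congr rfl fun σ _ => ?_
  congr 1
  rw [← Equiv.sum_comp σ]
  simp only [Matrix.of_apply, Equiv.Perm.inv_def, Equiv.symm_apply_apply, Complex.ofReal_sum,
    Finset.mul_sum,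
    Complex.exp_sum]

lemma contDiff_alternant : ContDiff ℝ ∞ (alternant κ) := by
  rw [alternant_eq_expSum]
  exact contDiff_expSum _ _

lemma laplacian_alternant (x : Fin N → ℝ) :
    ∑ j, pderiv j (pderiv j (alternant κ)) x = -((∑ j, κ j ^ 2 : ℝ) : ℂ) * alternant κ x := by
  rw [alternant_eq_expSum]
  exact laplacian_expSum _ _ _ (fun σ => Equiv.sum_comp σ⁻¹ (fun j => κ j ^ 2)) x

/-- On the line `x_l = s l` the roles of rows and columns swap: the matrix is the transpose of a
Vandermonde matrix with nodes `e^{-iκ_m s}`, whatever the exponents `κ`. -/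
lemma alternant_eq_prod (s : ℝ) :
    alternant κ (fun l => s * (l : ℕ)) = ∏ i : Fin N, ∏ j ∈ Finset.Ioi i,
      (Complex.exp (-Complex.I * ((κ j * s : ℝ) : ℂ)) -
        Complex.exp (-Complex.I * ((κ i * s : ℝ) : ℂ))) := by
  rw [← Matrix.det_vandermonde, ← Matrix.det_transpose, alternant]
  congr 1
  ext l m
  simp only [Matrix.of_apply, Matrix.transpose_apply, Matrix.vandermonde_apply]
  rw [← Complex.exp_nat_mul]
  congr 1
  push_cast
  ring

/-- Principal specialisation: the value at the origin of a quotient of alternants. -/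
lemma value_zero_of_mul_alternant {F : (Fin N → ℝ) → ℂ} (hF : Continuous F) (δ : Fin N → ℝ)
    (hδ : Function.Injective δ) (h : ∀ x, alternant δ x * F x = alternant κ x) :
    F 0 = ((∏ i : Fin N, ∏ j ∈ Finset.Ioi i, (κ j - κ i) / (δ j - δ i) : ℝ) : ℂ) := by
  -- Both alternants vanish at the origin. Dividing every factor by `s` turns it into a difference
  -- quotient, so the ratio has a limit as `s → 0`.
  have key : ∀ κ : Fin N → ℝ, Tendsto (fun s : ℝ => ∏ i : Fin N, ∏ j ∈ Finset.Ioi i,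
      ((s : ℂ)⁻¹ * (Complex.exp (-Complex.I * ((κ j * s : ℝ) : ℂ)) -
        Complex.exp (-Complex.I * ((κ i * s : ℝ) : ℂ))))) (𝓝[≠] 0)
      (𝓝 (∏ i : Fin N, ∏ j ∈ Finset.Ioi i, (-Complex.I * ((κ j - κ i : ℝ) : ℂ)))) := by
    intro κ
    refine tendsto_finsetProd _ fun i _ => tendsto_finsetProd _ fun j _ => ?_
    have hd : ∀ a : ℝ, HasDerivAt (fun s : ℝ => Complex.exp (-Complex.I * ((a * s : ℝ) : ℂ)))
        (-Complex.I * a) 0 := by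
      intro a
      have h1 : HasDerivAt (fun s : ℝ => -Complex.I * ((a * s : ℝ) : ℂ)) (-Complex.I * a) 0 := by
        have := ((hasDerivAt_id (0 : ℝ)).const_mul a).ofReal_comp.const_mul (-Complex.I)
        simpa using this
      simpa using h1.cexp
    have h2 := ((hd (κ j)).sub (hd (κ i))).tendsto_slope_zero
    simp only [zero_add, mul_zero, Complex.ofReal_zero, Complex.exp_zero, sub_self, sub_zero,
      Pi.sub_apply] at h2
    have h3 : -Complex.I * ((κ j - κ i : ℝ) : ℂ) = -Complex.I * κ j - -Complex.I * κ i := by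
      push_cast; ring
    rw [h3]
    refine h2.congr fun s => ?_
    rw [Complex.real_smul, Complex.ofReal_inv]
  have hFlim : Tendsto (fun s : ℝ => F (fun l => s * (l : ℕ))) (𝓝[≠] 0) (𝓝 (F 0)) := by
    have : Continuous fun s : ℝ => F (fun l : Fin N => s * (l : ℕ)) :=
      hF.comp (continuous_pi fun l => by fun_prop)
    have h0 := (this.tendsto 0).mono_left (nhdsWithin_le_nhds (s := {0}ᶜ))
    convert h0 using 2
    congr 1
    funext l
    simp
  have hlim := tendsto_nhds_unique (((key δ).mul hFlim).congr fun s => ?_) (key κ)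
  · have hne : (∏ i : Fin N, ∏ j ∈ Finset.Ioi i, (-Complex.I * ((δ j - δ i : ℝ) : ℂ))) ≠ 0 := by
      refine Finset.prod_ne_zero_iff.2 fun i _ => Finset.prod_ne_zero_iff.2 fun j hj => ?_
      refine mul_ne_zero (neg_ne_zero.2 Complex.I_ne_zero) ?_
      rw [Complex.ofReal_ne_zero, sub_ne_zero]
      exact fun e => (Finset.mem_Ioi.1 hj).ne' (hδ e)
    rw [mul_comm, ← eq_div_iff hne] at hlim
    rw [hlim, ← Finset.prod_div_distrib, Complex.ofReal_prod]
    refine Finset.prod_congr rfl fun i _ => ?_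
    rw [← Finset.prod_div_distrib, Complex.ofReal_prod]
    refine Finset.prod_congr rfl fun j _ => ?_
    rw [mul_div_mul_left _ _ (neg_ne_zero.2 Complex.I_ne_zero), Complex.ofReal_div]
  · have h1 := h (fun l => s * (l : ℕ))
    rw [alternant_eq_prod, alternant_eq_prod] at h1
    simp only [Finset.prod_mul_distrib]
    rw [← h1]
    ring

end Alternant

/-! ### The potential -/

/-- The exponents of the Vandermonde determinant, centred at the origin. -/
noncomputable def rho (N : ℕ) (m : Fin N) : ℝ := (m : ℕ) - ((N : ℝ) - 1) / 2

lemma rho_injective (N : ℕ) : Function.Injective (rho N) := by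
  intro a b h
  simpa [rho, Fin.ext_iff] using h

/-- The points `exp (-i x_l)` on the unit circle. -/
noncomputable def circlePoint {N : ℕ} (x : Fin N → ℝ) (l : Fin N) : ℂ :=
  Complex.exp (-Complex.I * (x l : ℂ))

/-- The product `∏_{i < j} 2 sin ((x_j - x_i) / 2)`. -/
noncomputable def sineProd (N : ℕ) (x : Fin N → ℝ) : ℝ :=
  ∏ i : Fin N, ∏ j ∈ Finset.Ioi i, 2 * Real.sin ((x j - x i) / 2)

section Potential

variable {N : ℕ}

/-- A general square root `c` of `-1` serves both `W`, written with `I`, and the circle points,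
written with `-I`. -/
lemma exp_sub_exp (c : ℂ) (a b : ℝ) (hc : c ^ 2 = -1) :
    Complex.exp (c * b) - Complex.exp (c * a) =
      Complex.exp (c * ((a + b : ℝ) : ℂ) / 2) * (2 * c * (Real.sin ((b - a) / 2) : ℝ)) := by
  have h : ∀ y : ℝ, Complex.exp (c * y) = Real.cos y + Real.sin y * c := by
    intro y
    rcases eq_or_ne c Complex.I with rfl | h1
    · rw [mul_comm, Complex.exp_mul_I, Complex.ofReal_cos, Complex.ofReal_sin]
    · have : c = -Complex.I := by
        have : (c - Complex.I) * (c + Complex.I) = 0 := by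
          linear_combination hc - Complex.I_sq
        rcases mul_eq_zero.1 this with h2 | h2
        · exact absurd (sub_eq_zero.1 h2) h1
        · exact eq_neg_of_add_eq_zero_left h2
      subst this
      rw [show -Complex.I * (y : ℂ) = ((-y : ℝ) : ℂ) * Complex.I by push_cast; ring,
        Complex.exp_mul_I, ← Complex.ofReal_cos, ← Complex.ofReal_sin, Real.cos_neg, Real.sin_neg]
      push_cast; ring
  have hs := h ((b - a) / 2)
  have hs' := h (-((b - a) / 2))
  rw [Real.cos_neg, Real.sin_neg] at hs'
  have e1 : Complex.exp (c * b) =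
      Complex.exp (c * ((a + b : ℝ) : ℂ) / 2) * Complex.exp (c * ((b - a) / 2 : ℝ)) := by
    rw [← Complex.exp_add]; congr 1; push_cast; ring
  have e2 : Complex.exp (c * a) =
      Complex.exp (c * ((a + b : ℝ) : ℂ) / 2) * Complex.exp (c * (-((b - a) / 2) : ℝ)) := by
    rw [← Complex.exp_add]; congr 1; push_cast; ring
  rw [e1, e2, hs, hs']
  push_cast
  ring

lemma contDiff_sineProd : ContDiff ℝ ∞ (sineProd N) := by
  unfold sineProd
  refine contDiff_prod fun i _ => contDiff_prod fun j _ => contDiff_const.mul ?_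
  exact Real.contDiff_sin.comp (((contDiff_apply ℝ ℝ j).sub (contDiff_apply ℝ ℝ i)).div_const 2)

/-- Each angle belongs to exactly `N - 1` pairs. -/
lemma prod_exp_half (x : Fin N → ℝ) :
    ∏ i : Fin N, ∏ j ∈ Finset.Ioi i, Complex.exp (-Complex.I * ((x i + x j : ℝ) : ℂ) / 2) =
      ∏ l : Fin N, Complex.exp (-Complex.I * ((((N : ℝ) - 1) / 2 * x l : ℝ) : ℂ)) := by
  simp only [← Complex.exp_sum]
  congr 1
  have h := Finset.sum_sum_Ioi_add_eq_sum_sum_off_diag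
    (fun i j : Fin N => -Complex.I * (x i : ℂ) / 2)
  have h2 : ∀ i : Fin N, ∑ j ∈ ({i}ᶜ : Finset (Fin N)), -Complex.I * (x j : ℂ) / 2 =
      (∑ j, -Complex.I * (x j : ℂ) / 2) - -Complex.I * (x i : ℂ) / 2 := by
    intro i
    rw [Finset.compl_eq_univ_sdiff, Finset.sum_sdiff_eq_sub (Finset.subset_univ _),
      Finset.sum_singleton]
  rw [Finset.sum_congr rfl fun i _ => h2 i, Finset.sum_sub_distrib, Finset.sum_const,
    Finset.card_univ, Fintype.card_fin, nsmul_eq_mul] at h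
  refine Eq.trans (Finset.sum_congr rfl fun i _ => Finset.sum_congr rfl fun j _ => ?_)
    (h.trans ?_)
  · push_cast; ring
  · rw [Finset.mul_sum, ← Finset.sum_sub_distrib]
    exact Finset.sum_congr rfl fun l _ => by push_cast; ring

lemma det_vandermonde_circlePoint (x : Fin N → ℝ) :
    (Matrix.vandermonde (circlePoint x)).det =
      (∏ l : Fin N, Complex.exp (-Complex.I * ((((N : ℝ) - 1) / 2 * x l : ℝ) : ℂ))) *
        ((∏ i : Fin N, ∏ _j ∈ Finset.Ioi i, -Complex.I) * sineProd N x) := by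
  rw [Matrix.det_vandermonde, ← prod_exp_half, sineProd, Complex.ofReal_prod]
  simp only [Complex.ofReal_prod, ← Finset.prod_mul_distrib]
  refine Finset.prod_congr rfl fun i _ => Finset.prod_congr rfl fun j _ => ?_
  rw [circlePoint, circlePoint, exp_sub_exp (-Complex.I) _ _ (by simp)]
  push_cast
  ring

lemma prod_exp_mul_det (x : Fin N → ℝ) (M : Matrix (Fin N) (Fin N) ℂ) :
    (∏ l : Fin N, Complex.exp (-Complex.I * ((((N : ℝ) - 1) / 2 * x l : ℝ) : ℂ))) *
      (Matrix.of fun l m => Complex.exp (Complex.I * ((((N : ℝ) - 1) / 2 * x l : ℝ) : ℂ)) *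
        M l m).det = M.det := by
  rw [Matrix.det_mul_column, ← mul_assoc, ← Finset.prod_mul_distrib]
  simp [← Complex.exp_add]

/-- Centring the exponents cancels the phase of the Vandermonde determinant; what remains is a
constant times a real function, whose logarithm can be compared with `W`. -/
lemma alternant_rho (x : Fin N → ℝ) :
    alternant (rho N) x = (∏ i : Fin N, ∏ _j ∈ Finset.Ioi i, -Complex.I) * sineProd N x := by
  have h := prod_exp_mul_det x (Matrix.vandermonde (circlePoint x))
  rw [det_vandermonde_circlePoint] at h
  have hne : (∏ l : Fin N, Complex.exp (-Complex.I * ((((N : ℝ) - 1) / 2 * x l : ℝ) : ℂ))) ≠ 0 :=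
    Finset.prod_ne_zero_iff.2 fun _ _ => Complex.exp_ne_zero _
  rw [← mul_left_cancel₀ hne h, alternant]
  congr 1
  ext l m
  rw [Matrix.of_apply, Matrix.of_apply, Matrix.vandermonde_apply, circlePoint,
    ← Complex.exp_nat_mul, ← Complex.exp_add, rho]
  congr 1
  push_cast
  ring

lemma prod_neg_I_ne_zero : (∏ i : Fin N, ∏ _j ∈ Finset.Ioi i, -Complex.I) ≠ 0 :=
  Finset.prod_ne_zero_iff.2 fun _ _ => Finset.prod_ne_zero_iff.2 fun _ _ =>
    neg_ne_zero.2 Complex.I_ne_zero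

lemma sineProd_ne_zero_iff (x : Fin N → ℝ) : sineProd N x ≠ 0 ↔ alternant (rho N) x ≠ 0 := by
  rw [alternant_rho, mul_ne_zero_iff, Complex.ofReal_ne_zero]
  exact ⟨fun h => ⟨prod_neg_I_ne_zero, h⟩, fun h => h.2⟩

/-- No absolute value is needed, since `Real.log` is even. -/
lemma potentialW_eq (x : Fin N → ℝ) (hx : sineProd N x ≠ 0) :
    potentialW N x = -Real.log (sineProd N x) := by
  have hx' := hx
  rw [sineProd, Finset.prod_ne_zero_iff] at hx'
  rw [potentialW, sineProd, Real.log_prod (fun i hi => hx' i hi)]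
  congr 1
  refine Finset.sum_congr rfl fun i hi => ?_
  rw [Real.log_prod (fun j hj => Finset.prod_ne_zero_iff.1 (hx' i hi) j hj)]
  refine Finset.sum_congr rfl fun j _ => ?_
  rw [exp_sub_exp Complex.I _ _ Complex.I_sq, norm_mul, norm_mul, norm_mul, mul_div_assoc,
    mul_comm Complex.I, ← Complex.ofReal_ofNat, ← Complex.ofReal_div, Complex.norm_exp_ofReal_mul_I,
    Complex.norm_I, Complex.norm_real, Complex.norm_real, mul_one, one_mul, ← norm_mul,
    Real.norm_eq_abs, Real.log_abs]

/-- The drift is the logarithmic derivative of the Vandermonde alternant. -/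
lemma pderiv_potentialW_mul (x : Fin N → ℝ) (hx : alternant (rho N) x ≠ 0) (j : Fin N) :
    -((pderiv j (potentialW N) x : ℝ) : ℂ) * alternant (rho N) x =
      pderiv j (alternant (rho N)) x := by
  have hx' := (sineProd_ne_zero_iff x).2 hx
  have hd : DifferentiableAt ℝ (sineProd N) x :=
    contDiff_sineProd.differentiable (by simp) x
  have h1 : potentialW N =ᶠ[𝓝 x] fun y => -Real.log (sineProd N y) := by
    filter_upwards [hd.continuousAt.eventually_ne hx'] with y hy using potentialW_eq y hy
  rw [pderiv_congr h1, pderiv_eq_of_hasFDerivAt (hd.hasFDerivAt.log hx').fun_neg]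
  have h2 : alternant (rho N) =
      fun y => (∏ i : Fin N, ∏ _j ∈ Finset.Ioi i, -Complex.I) * (sineProd N y : ℂ) :=
    funext alternant_rho
  have h3 := (Complex.ofRealCLM.hasFDerivAt.comp x hd.hasFDerivAt).const_mul
    (∏ i : Fin N, ∏ _j ∈ Finset.Ioi i, -Complex.I)
  rw [h2]
  refine Eq.trans ?_ (pderiv_eq_of_hasFDerivAt h3).symm
  have hx2 : (sineProd N x : ℂ) ≠ 0 := Complex.ofReal_ne_zero.2 hx'
  simp
  field_simp

/-- A smooth function `F` such that `F` times the Vandermonde alternant is an alternant is an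
eigenfunction of the adjoint Fokker-Planck operator. -/
lemma adjointFP_eq_of_mul_alternant (κ : Fin N → ℝ) {F : (Fin N → ℝ) → ℂ}
    (hF : ContDiff ℝ ∞ F) (h : ∀ x, alternant (rho N) x * F x = alternant κ x)
    (x : Fin N → ℝ) (hx : alternant (rho N) x ≠ 0) :
    adjointFP N F x = (((∑ j, rho N j ^ 2 - ∑ j, κ j ^ 2) / 2 : ℝ) : ℂ) * F x := by
  have hA := contDiff_alternant (rho N)
  have d : ∀ {f : (Fin N → ℝ) → ℂ}, ContDiff ℝ ∞ f → ∀ y, DifferentiableAt ℝ f y :=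
    fun hf y => hf.differentiable (by simp) y
  have h1 : ∀ j, pderiv j (alternant κ) = fun y =>
      pderiv j (alternant (rho N)) y * F y + alternant (rho N) y * pderiv j F y := by
    intro j
    funext y
    rw [← pderiv_mul (d hA y) (d hF y)]
    congr 1
    exact funext fun y => (h y).symm
  -- After summation the cross term is twice `A` times the drift part of the adjoint operator, with
  -- `A = alternant (rho N)`.
  have h2 : ∀ j, pderiv j (pderiv j (alternant κ)) x =
      pderiv j (pderiv j (alternant (rho N))) x * F x +
        2 * (pderiv j (alternant (rho N)) x * pderiv j F x) +
        alternant (rho N) x * pderiv j (pderiv j F) x := by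
    intro j
    have hA' := contDiff_pderiv (j := j) hA
    have hF' := contDiff_pderiv (j := j) hF
    rw [h1, pderiv_add (d (hA'.mul hF) x) (d (hA.mul hF') x), pderiv_mul (d hA' x) (d hF x),
      pderiv_mul (d hA x) (d hF' x)]
    ring
  have h3 := laplacian_alternant κ x
  have h4 := laplacian_alternant (rho N) x
  rw [Finset.sum_congr rfl fun j _ => h2 j, Finset.sum_add_distrib, Finset.sum_add_distrib,
    ← Finset.sum_mul, h4, ← h x, ← Finset.mul_sum, ← Finset.mul_sum] at h3
  refine mul_left_cancel₀ hx ?_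
  rw [adjointFP, Finset.sum_add_distrib, ← Finset.mul_sum, mul_add, Finset.mul_sum]
  have h5 : ∑ j, alternant (rho N) x * (-((pderiv j (potentialW N) x : ℝ) : ℂ) * pderiv j F x) =
      ∑ j, pderiv j (alternant (rho N)) x * pderiv j F x := by
    refine Finset.sum_congr rfl fun j _ => ?_
    rw [← pderiv_potentialW_mul x hx j]
    ring
  rw [h5]
  push_cast at h3 ⊢
  linear_combination h3 / 2

end Potential

/-! ### The companion matrix of the eigenvalues -/

/-- The companion matrix of `∏ l, (X - v l)`. -/
noncomputable def companion {N : ℕ} (v : Fin N → ℂ) : Matrix (Fin N) (Fin N) ℂ :=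
  Matrix.of fun m n => if (n : ℕ) + 1 < N then (if (m : ℕ) = n + 1 then 1 else 0)
    else -(∏ l, (Polynomial.X - Polynomial.C (v l))).coeff m

section Companion

variable {N : ℕ}

/-- The row `(1, v_l, …, v_l^(N-1))` is a left eigenvector of the companion matrix with eigenvalue
`v_l`; the last column uses that `v_l` is a root. Distinct nodes are not required. -/
lemma vandermonde_mul_companion (v : Fin N → ℂ) :
    Matrix.vandermonde v * companion v = Matrix.diagonal v * Matrix.vandermonde v := by
  ext l n
  rw [Matrix.diagonal_mul, Matrix.mul_apply]
  simp only [Matrix.vandermonde_apply, companion, Matrix.of_apply]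
  rw [← pow_succ']
  split_ifs with h
  · rw [Finset.sum_eq_single ⟨n + 1, h⟩]
    · simp
    · intro m _ hm
      rw [if_neg (fun e => hm (Fin.ext e)), mul_zero]
    · simp
  · have hn : (n : ℕ) + 1 = N := by omega
    have hmonic : (∏ l, (Polynomial.X - Polynomial.C (v l))).Monic :=
      Polynomial.monic_prod_X_sub_C v _
    have hdeg : (∏ l, (Polynomial.X - Polynomial.C (v l))).natDegree = N := by
      rw [Polynomial.natDegree_finsetProd_X_sub_C_eq_card]; simp
    have hroot : (∏ l, (Polynomial.X - Polynomial.C (v l))).eval (v l) = 0 := by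
      rw [Polynomial.eval_prod]
      exact Finset.prod_eq_zero (Finset.mem_univ l) (by simp)
    have hlead := hmonic.coeff_natDegree
    rw [hdeg] at hlead
    rw [Polynomial.eval_eq_sum_range, hdeg, Finset.sum_range_succ, hlead, one_mul,
      Finset.sum_range] at hroot
    rw [hn, eq_neg_of_add_eq_zero_right hroot, ← Finset.sum_neg_distrib]
    exact Finset.sum_congr rfl fun m _ => by ring

lemma vandermonde_mul_companion_pow (v : Fin N → ℂ) (k : ℕ) :
    Matrix.vandermonde v * companion v ^ k =
      Matrix.diagonal (fun l => v l ^ k) * Matrix.vandermonde v := by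
  induction k with
  | zero => simp
  | succ k ih =>
    rw [pow_succ, ← mul_assoc, ih, mul_assoc, vandermonde_mul_companion, ← mul_assoc,
      Matrix.diagonal_mul_diagonal]
    simp only [pow_succ]

/-- Column `p` of the `k`-th power solves the linear system with Vandermonde matrix and right-hand
side `v_l^(k+p)`; this is Cramer's rule for its `p`-th unknown. -/
lemma det_vandermonde_mul_companion_pow (v : Fin N → ℂ) (k : ℕ) (p : Fin N) :
    (Matrix.vandermonde v).det * (companion v ^ k) p p =
      ((Matrix.vandermonde v).updateCol p (fun l => v l ^ (k + (p : ℕ)))).det := by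
  have h : (Matrix.vandermonde v).mulVec (fun m => (companion v ^ k) m p) =
      fun l => v l ^ (k + (p : ℕ)) := by
    funext l
    have := congrFun (congrFun (vandermonde_mul_companion_pow v k) l) p
    rw [Matrix.diagonal_mul, Matrix.mul_apply, Matrix.vandermonde_apply, ← pow_add] at this
    exact this
  rw [← Matrix.cramer_apply, ← h, Matrix.cramer_eq_adjugate_mulVec, Matrix.mulVec_mulVec,
    Matrix.adjugate_mul, Matrix.smul_mulVec, Matrix.one_mulVec]
  rfl

/-- An invertible Vandermonde matrix diagonalises the companion matrix. -/
lemma trace_companion_pow (v : Fin N → ℂ) (hv : (Matrix.vandermonde v).det ≠ 0) (k : ℕ) :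
    ∑ p, (companion v ^ k) p p = ∑ l, v l ^ k := by
  have hu : IsUnit (Matrix.vandermonde v).det := isUnit_iff_ne_zero.2 hv
  have h : companion v ^ k =
      (Matrix.vandermonde v)⁻¹ * (Matrix.diagonal (fun l => v l ^ k) * Matrix.vandermonde v) := by
    rw [← vandermonde_mul_companion_pow, ← mul_assoc, Matrix.nonsing_inv_mul _ hu, one_mul]
  have h2 : (companion v ^ k).trace = ∑ l, v l ^ k := by
    rw [h, Matrix.trace_mul_comm, mul_assoc, Matrix.mul_nonsing_inv _ hu, mul_one,
      Matrix.trace_diagonal]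
  exact h2

/-- The diagonal entries of the powers of the companion matrix, as functions of the angles. -/
noncomputable def companionDiag (k : ℕ) (p : Fin N) (x : Fin N → ℝ) : ℂ :=
  (companion (circlePoint x) ^ k) p p

lemma contDiff_circlePoint (l : Fin N) :
    ContDiff ℝ ∞ (fun x : Fin N → ℝ => circlePoint x l) :=
  ContDiff.cexp (contDiff_const.mul (Complex.ofRealCLM.contDiff.comp (contDiff_apply ℝ ℝ l)))

/-- Smoothness of the companion entries at coincident eigenvalues rests on this: no division by the
Vandermonde determinant occurs. -/
lemma contDiff_coeff_prod (s : Finset (Fin N)) (m : ℕ) : ContDiff ℝ ∞ (fun x : Fin N → ℝ =>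
    (∏ l ∈ s, (Polynomial.X - Polynomial.C (circlePoint x l))).coeff m) := by
  induction s using Finset.induction_on generalizing m with
  | empty => simpa using contDiff_const
  | insert a s ha ih =>
    simp only [Finset.prod_insert ha, sub_mul, Polynomial.coeff_sub, Polynomial.coeff_C_mul]
    refine ContDiff.sub ?_ ((contDiff_circlePoint a).mul (ih m))
    cases m with
    | zero => simpa using contDiff_const
    | succ m => simpa only [Polynomial.coeff_X_mul] using ih m

lemma contDiff_companion_pow (k : ℕ) (m n : Fin N) :
    ContDiff ℝ ∞ (fun x : Fin N → ℝ => (companion (circlePoint x) ^ k) m n) := by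
  induction k generalizing m n with
  | zero => simpa using contDiff_const
  | succ k ih =>
    simp only [pow_succ, Matrix.mul_apply]
    refine ContDiff.sum fun i _ => (ih m i).mul ?_
    simp only [companion, Matrix.of_apply]
    split_ifs
    · exact contDiff_const
    · exact contDiff_const
    · exact (contDiff_coeff_prod _ _).neg

lemma circlePoint_add_single (x : Fin N → ℝ) (j : Fin N) :
    circlePoint (x + Pi.single j (2 * Real.pi)) = circlePoint x := by
  funext l
  rw [circlePoint, circlePoint, Pi.add_apply]
  rcases eq_or_ne l j with rfl | h
  · rw [Pi.single_eq_same, Complex.exp_eq_exp_iff_exists_int]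
    exact ⟨-1, by push_cast; ring⟩
  · rw [Pi.single_eq_of_ne h, add_zero]

lemma isTestFunction_companionDiag (k : ℕ) (p : Fin N) : IsTestFunction (companionDiag k p) where
  smooth := contDiff_companion_pow k p p
  periodic x j := by rw [companionDiag, circlePoint_add_single, companionDiag]

lemma det_updateCol_circlePoint (κ : Fin N → ℝ) (k : ℕ) (p : Fin N)
    (hκ : ∀ m, κ m = rho N m + if m = p then (k : ℝ) else 0) (x : Fin N → ℝ) :
    (∏ l : Fin N, Complex.exp (-Complex.I * ((((N : ℝ) - 1) / 2 * x l : ℝ) : ℂ))) *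
      alternant κ x = ((Matrix.vandermonde (circlePoint x)).updateCol p
        (fun l => circlePoint x l ^ (k + (p : ℕ)))).det := by
  rw [← prod_exp_mul_det x, alternant]
  congr 2
  ext l m
  rw [Matrix.of_apply, Matrix.of_apply, Matrix.updateCol_apply, hκ, rho]
  split_ifs with h
  · subst h
    rw [circlePoint, ← Complex.exp_nat_mul, ← Complex.exp_add]
    congr 1
    push_cast
    ring
  · rw [Matrix.vandermonde_apply, circlePoint, ← Complex.exp_nat_mul, ← Complex.exp_add]
    congr 1
    push_cast
    ring

/-- The exponents `rho` with the `p`-th one shifted by `k`. -/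
noncomputable def shiftedRho (N k : ℕ) (p m : Fin N) : ℝ :=
  rho N m + if m = p then (k : ℝ) else 0

/-- Cramer's rule for the circle points, after cancelling the nonvanishing phase common to both
determinants. -/
lemma alternant_mul_companionDiag (k : ℕ) (p : Fin N) (x : Fin N → ℝ) :
    alternant (rho N) x * companionDiag k p x = alternant (shiftedRho N k p) x := by
  have h := det_vandermonde_mul_companion_pow (circlePoint x) k p
  rw [← det_updateCol_circlePoint (shiftedRho N k p) k p (fun _ => rfl),
    det_vandermonde_circlePoint, mul_assoc, ← alternant_rho] at h
  exact mul_left_cancel₀ (Finset.prod_ne_zero_iff.2 fun _ _ => Complex.exp_ne_zero _) h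

lemma sum_sq_shiftedRho (k : ℕ) (p : Fin N) :
    ∑ m, rho N m ^ 2 - ∑ m, shiftedRho N k p m ^ 2 = -(k ^ 2 + 2 * k * rho N p) := by
  rw [← Finset.sum_sub_distrib, Finset.sum_eq_single p]
  · simp [shiftedRho]; ring
  · intro m _ hm
    simp [shiftedRho, hm]
  · simp

/-! ### Coincidences of eigenvalues are negligible -/

/-- The zero set lies in the countable union of the affine hyperplanes `x_j - x_i = 2πn`. -/
lemma ae_alternant_rho_ne_zero : ∀ᵐ x : Fin N → ℝ, alternant (rho N) x ≠ 0 := by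
  have h : ∀ i j : Fin N, i ≠ j → ∀ n : ℤ,
      ∀ᵐ x : Fin N → ℝ, x j - x i ≠ n * (2 * Real.pi) := by
    intro i j hij n
    have key := Measure.addHaar_affineSubspace (volume : Measure (Fin N → ℝ))
      ((AffineSubspace.mk' (n * (2 * Real.pi) : ℝ) (⊥ : Submodule ℝ ℝ)).comap
        (LinearMap.proj (R := ℝ) (φ := fun _ : Fin N => ℝ) j -
          LinearMap.proj (R := ℝ) (φ := fun _ : Fin N => ℝ) i).toAffineMap) ?_
    · rw [ae_iff]
      convert key using 2
      ext x
      simp [AffineSubspace.mem_mk', sub_eq_zero]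
    · intro htop
      -- A point with `x_j - x_i = 2πn + 1` lies off the hyperplane, which is therefore proper.
      have h1 : (Pi.single j (n * (2 * Real.pi) + 1) : Fin N → ℝ) ∈
          (⊤ : AffineSubspace ℝ (Fin N → ℝ)) := AffineSubspace.mem_top _ _ _
      rw [← htop] at h1
      simp [AffineSubspace.mem_mk', Pi.single_eq_of_ne hij] at h1
  have h2 : ∀ᵐ x : Fin N → ℝ, ∀ i j : Fin N, i ≠ j → ∀ n : ℤ, x j - x i ≠ n * (2 * Real.pi) := by
    refine ae_all_iff.2 fun i => ae_all_iff.2 fun j => ?_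
    by_cases hij : i = j
    · simp [hij]
    · simpa [hij] using ae_all_iff.2 (h i j hij)
  filter_upwards [h2] with x hx
  rw [← sineProd_ne_zero_iff, sineProd]
  refine Finset.prod_ne_zero_iff.2 fun i _ => Finset.prod_ne_zero_iff.2 fun j hj => ?_
  refine mul_ne_zero two_ne_zero fun hs => ?_
  obtain ⟨n, hn⟩ := Real.sin_eq_zero_iff.1 hs
  exact hx i j (Finset.mem_Ioi.1 hj).ne n (by linarith)

/-- The trace formula holds for distinct points; both sides are continuous and such configurations
are dense. -/
lemma sum_companionDiag (k : ℕ) (x : Fin N → ℝ) :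
    ∑ p, companionDiag k p x = ∑ l, circlePoint x l ^ k := by
  have hd : Dense {x : Fin N → ℝ | alternant (rho N) x ≠ 0} :=
    Measure.dense_of_ae ae_alternant_rho_ne_zero
  have h1 : Continuous fun x : Fin N → ℝ => ∑ p, companionDiag k p x :=
    continuous_finsetSum _ fun p _ => (isTestFunction_companionDiag k p).smooth.continuous
  have h2 : Continuous fun x : Fin N → ℝ => ∑ l, circlePoint x l ^ k :=
    continuous_finsetSum _ fun l _ => (contDiff_circlePoint l).continuous.pow k
  refine congrFun (Continuous.ext_on hd h1 h2 fun x hx => trace_companion_pow _ ?_ k) x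
  rw [det_vandermonde_circlePoint, ← alternant_rho]
  exact mul_ne_zero (Finset.prod_ne_zero_iff.2 fun _ _ => Complex.exp_ne_zero _) hx

lemma adjointFP_companionDiag (k : ℕ) (p : Fin N) (x : Fin N → ℝ)
    (hx : alternant (rho N) x ≠ 0) : adjointFP N (companionDiag k p) x =
      ((-(k ^ 2 + 2 * k * rho N p) / 2 : ℝ) : ℂ) * companionDiag k p x := by
  rw [← sum_sq_shiftedRho]
  exact adjointFP_eq_of_mul_alternant _ (isTestFunction_companionDiag k p).smooth
    (alternant_mul_companionDiag k p) x hx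

lemma companionDiag_zero (k : ℕ) (p : Fin N) : companionDiag k p 0 =
    ((∏ i : Fin N, ∏ j ∈ Finset.Ioi i, (shiftedRho N k p j - shiftedRho N k p i) /
      (rho N j - rho N i) : ℝ) : ℂ) :=
  value_zero_of_mul_alternant _ (isTestFunction_companionDiag k p).smooth.continuous _
    (rho_injective N) (alternant_mul_companionDiag k p)

end Companion

/-! ### Generalized binomial coefficients and terminating hypergeometric series -/

lemma descPochhammer_eval_eq_choose (a : ℝ) (n : ℕ) :
    (descPochhammer ℝ n).eval a = n.factorial * Ring.choose a n := by
  rw [← nsmul_eq_mul, ← Ring.descPochhammer_eq_factorial_smul_choose,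
    ← descPochhammer_map (Int.castRingHom ℝ), Polynomial.eval_map]
  rw [← Polynomial.aeval_eq_smeval]
  rfl

lemma choose_eq_prod (a : ℝ) (n : ℕ) :
    Ring.choose a n = ∏ u ∈ Finset.range n, (a - u) / ((u : ℝ) + 1) := by
  have h := descPochhammer_eval_eq_choose a n
  rw [descPochhammer_eval_eq_prod_range] at h
  have hf : ((n.factorial : ℕ) : ℝ) = ∏ u ∈ Finset.range n, ((u : ℝ) + 1) := by
    rw [← Finset.prod_range_add_one_eq_factorial]; push_cast; rfl
  rw [Finset.prod_div_distrib, h, ← hf,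
    mul_div_cancel_left₀ _ (Nat.cast_ne_zero.2 n.factorial_ne_zero)]

lemma ascPochhammer_eval_neg_eq_choose (a : ℝ) (n : ℕ) :
    (ascPochhammer ℝ n).eval (-a) = (-1) ^ n * (n.factorial * Ring.choose a n) := by
  rw [ascPochhammer_eval_neg_eq_descPochhammer, descPochhammer_eval_eq_choose]

lemma choose_neg_eq (a : ℝ) (n : ℕ) :
    Ring.choose (-a) n = (-1) ^ n * Ring.choose (a + n - 1) n := by
  have h1 := ascPochhammer_eval_neg_eq_choose (-a) n
  have h2 := descPochhammer_eval_eq_choose (a + n - 1) n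
  rw [descPochhammer_eval_eq_ascPochhammer, show a + n - 1 - n + 1 = a by ring] at h2
  rw [neg_neg, h2] at h1
  have hs : ((-1 : ℝ) ^ n) * (-1) ^ n = 1 := by rw [← mul_pow]; simp
  refine mul_left_cancel₀ (Nat.cast_ne_zero.2 n.factorial_ne_zero : (n.factorial : ℝ) ≠ 0) ?_
  linear_combination (-(-1) ^ n) * h1 - (n.factorial : ℝ) * Ring.choose (-a) n * hs

/-- A terminating hypergeometric series is a finite sum. -/
lemma hypergeometric_neg_nat (n : ℕ) (b c z : ℝ) :
    ordinaryHypergeometric (-(n : ℝ)) b c z = ∑ m ∈ Finset.range (n + 1),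
      (m.factorial : ℝ)⁻¹ * (ascPochhammer ℝ m).eval (-(n : ℝ)) * (ascPochhammer ℝ m).eval b *
        ((ascPochhammer ℝ m).eval c)⁻¹ * z ^ m := by
  rw [ordinaryHypergeometric_eq_tsum]
  simp only [smul_eq_mul]
  refine tsum_eq_sum fun m hm => ?_
  rw [ascPochhammer_eval_neg_coe_nat_of_lt (by simpa using hm)]
  simp

/-- Uses `(2)_m = (m+1)!` and `(n+1) (n choose m) = (m+1) (n+1 choose m+1)`. The factor `n + 1` is
`N`. -/
lemma hypergeometric_two (n : ℕ) (b z : ℝ) :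
    ((n : ℝ) + 1) * ordinaryHypergeometric (-(n : ℝ)) (-b) 2 z = ∑ m ∈ Finset.range (n + 1),
      Ring.choose ((n : ℝ) + 1) (n - m) * Ring.choose b m * z ^ m := by
  rw [hypergeometric_neg_nat, Finset.mul_sum]
  refine Finset.sum_congr rfl fun m hm => ?_
  have hmn : m ≤ n := Nat.lt_succ_iff.1 (Finset.mem_range.1 hm)
  have h2 : (ascPochhammer ℝ m).eval 2 = ((m + 1).factorial : ℝ) := by
    have := Nat.factorial_mul_ascFactorial 1 m
    rw [Nat.factorial_one, one_mul, ← ascPochhammer_nat_eq_ascFactorial, add_comm 1 m] at this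
    rw [← this, ascPochhammer_eval_cast]
    norm_num
  have h3 : (n + 1 : ℝ) * Ring.choose (n : ℝ) m =
      Ring.choose ((n : ℝ) + 1) (n - m) * ((m : ℝ) + 1) := by
    have h4 : (n + 1).choose (n - m) = (n + 1).choose (m + 1) := by
      rw [← Nat.choose_symm (by omega : m + 1 ≤ n + 1)]; congr 1; omega
    rw [← Nat.cast_succ, Ring.choose_natCast, Ring.choose_natCast]
    have := Nat.add_one_mul_choose_eq n m
    rw [Nat.succ_eq_add_one, h4]
    exact_mod_cast this
  rw [ascPochhammer_eval_neg_eq_choose, ascPochhammer_eval_neg_eq_choose, h2, Nat.factorial_succ]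
  have hf : (m.factorial : ℝ) ≠ 0 := Nat.cast_ne_zero.2 m.factorial_ne_zero
  have hm1 : (m : ℝ) + 1 ≠ 0 := by positivity
  have hs : ((-1 : ℝ) ^ m) * (-1) ^ m = 1 := by rw [← mul_pow]; simp
  push_cast
  field_simp
  have hs2 : ((-1 : ℝ) ^ m) ^ 2 = 1 := by rw [sq, hs]
  rw [hs2]
  linear_combination (Ring.choose b m * z ^ m) * h3

/-! ### The moments as polynomials -/

/-- The polynomial `∑_p (k+p choose p) (-1)^(n-p) (k-1 choose n-p) y^p`. -/
noncomputable def momentPoly (n : ℕ) (k y : ℝ) : ℝ :=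
  ∑ p ∈ Finset.range (n + 1), Ring.choose (k + p) p *
    ((-1) ^ (n - p) * Ring.choose (k - 1) (n - p)) * y ^ p

/-- Trinomial revision, `(b choose s)(s choose j) = (b choose j)(b-j choose s-j)`, followed by
Chu–Vandermonde. -/
lemma sum_choose_mul_choose (n j : ℕ) (hj : j ≤ n) (b : ℝ) :
    ∑ s ∈ Finset.range (n + 1), Ring.choose ((n : ℝ) + 1) (n - s) * Ring.choose b s * s.choose j =
      Ring.choose b j * Ring.choose ((n : ℝ) + 1 + (b - j)) (n - j) := by
  obtain ⟨d, rfl⟩ := Nat.exists_eq_add_of_le hj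
  rw [add_assoc, Finset.sum_range_add, Finset.sum_eq_zero, zero_add, Nat.add_sub_cancel_left,
    add_comm (((j + d : ℕ) : ℝ) + 1), Ring.add_choose_eq d (Commute.all _ _),
    Finset.Nat.sum_antidiagonal_eq_sum_range_succ_mk, Finset.mul_sum]
  · refine Finset.sum_congr rfl fun i hi => ?_
    have h := Ring.choose_smul_choose b (Nat.le_add_right j i)
    rw [nsmul_eq_mul, Nat.add_sub_cancel_left] at h
    rw [Nat.add_sub_add_left]
    linear_combination (Ring.choose (((j + d : ℕ) : ℝ) + 1) (d - i)) * h
  · intro s hs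
    rw [Nat.choose_eq_zero_of_lt (Finset.mem_range.1 hs)]
    simp

/-- Common tool for the Jacobi and hypergeometric forms: expand the weight binomially, exchange the
sums, and evaluate the inner one. -/
lemma sum_choose_mul_pow (n : ℕ) (b : ℝ) (g : ℕ → ℝ) (w : ℕ → ℝ)
    (hw : ∀ s ≤ n, w s = ∑ j ∈ Finset.range (n + 1), s.choose j * g j) :
    ∑ s ∈ Finset.range (n + 1), Ring.choose ((n : ℝ) + 1) (n - s) * Ring.choose b s * w s =
      ∑ j ∈ Finset.range (n + 1),
        Ring.choose b j * Ring.choose ((n : ℝ) + 1 + (b - j)) (n - j) * g j := by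
  have h1 : ∀ s ∈ Finset.range (n + 1),
      Ring.choose ((n : ℝ) + 1) (n - s) * Ring.choose b s * w s =
        ∑ j ∈ Finset.range (n + 1),
          Ring.choose ((n : ℝ) + 1) (n - s) * Ring.choose b s * s.choose j * g j := by
    intro s hs
    rw [hw s (Nat.lt_succ_iff.1 (Finset.mem_range.1 hs)), Finset.mul_sum]
    exact Finset.sum_congr rfl fun j _ => by ring
  rw [Finset.sum_congr rfl h1, Finset.sum_comm]
  refine Finset.sum_congr rfl fun j hj => ?_
  rw [← sum_choose_mul_choose n j (Nat.lt_succ_iff.1 (Finset.mem_range.1 hj)), Finset.sum_mul]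

lemma sum_range_choose_mul_extend {n s : ℕ} (hs : s ≤ n) (g : ℕ → ℝ) :
    ∑ j ∈ Finset.range (s + 1), s.choose j * g j =
      ∑ j ∈ Finset.range (n + 1), s.choose j * g j := by
  refine Finset.sum_subset (Finset.range_subset_range.2 (by omega)) fun j _ hj => ?_
  rw [Nat.choose_eq_zero_of_lt (by simpa using hj)]
  simp

lemma sum_jacobi_eq_momentPoly (n : ℕ) (k y : ℝ) :
    ∑ s ∈ Finset.range (n + 1), Ring.choose ((n : ℝ) + 1) (n - s) * Ring.choose (k - 1) s *
      ((y - 1) ^ s * y ^ (n - s)) = momentPoly n k y := by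
  rw [sum_choose_mul_pow n (k - 1) (fun r => (-1) ^ r * y ^ (n - r)), momentPoly,
    ← Finset.sum_range_reflect]
  · refine Finset.sum_congr rfl fun p hp => ?_
    have hp' : p ≤ n := Nat.lt_succ_iff.1 (Finset.mem_range.1 hp)
    rw [Nat.add_sub_cancel, Nat.sub_sub_self hp', Nat.cast_sub hp',
      show (n : ℝ) + 1 + (k - 1 - ((n : ℝ) - p)) = k + p by ring]
    ring
  · intro s hs
    rw [← sum_range_choose_mul_extend hs, sub_eq_add_neg, add_comm, add_pow, Finset.sum_mul]
    refine Finset.sum_congr rfl fun r hr => ?_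
    have : n - r = (s - r) + (n - s) := by have := Finset.mem_range.1 hr; omega
    rw [this, pow_add]
    ring

lemma jacobiP_eq_momentPoly (n : ℕ) (k y : ℝ) :
    jacobiP n 1 (k - ((n : ℝ) + 1)) (2 * y - 1) = momentPoly n k y := by
  rw [← sum_jacobi_eq_momentPoly, jacobiP]
  refine Finset.sum_congr rfl fun s _ => ?_
  rw [show (n : ℝ) + (k - (n + 1)) = k - 1 by ring, show (2 * y - 1 - 1) / 2 = y - 1 by ring,
    show (2 * y - 1 + 1) / 2 = y by ring]
  ring

/-- Reversing the summation exchanges the two parameters and the two linear factors. -/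
lemma jacobiP_neg (n : ℕ) (a b x : ℝ) : jacobiP n b a (-x) = (-1) ^ n * jacobiP n a b x := by
  rw [jacobiP, jacobiP, ← Finset.sum_range_reflect, Finset.mul_sum]
  refine Finset.sum_congr rfl fun s hs => ?_
  have hs' : s ≤ n := Nat.lt_succ_iff.1 (Finset.mem_range.1 hs)
  rw [Nat.add_sub_cancel, Nat.sub_sub_self hs',
    show (-x - 1) / 2 = -1 * ((x + 1) / 2) by ring, show (-x + 1) / 2 = -1 * ((x - 1) / 2) by ring,
    mul_pow, mul_pow, ← Nat.sub_add_cancel hs', pow_add (-1 : ℝ) (n - s) s]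
  simp only [Nat.sub_add_cancel hs']
  ring

/-- Expand `(1 - y)^s`; upper negation of both resulting binomial coefficients gives those of
`momentPoly`. -/
lemma hypergeometric_eq_momentPoly (n : ℕ) (k y : ℝ) :
    ((n : ℝ) + 1) * ordinaryHypergeometric (-(n : ℝ)) (1 + k) 2 (1 - y) = momentPoly n k y := by
  rw [show 1 + k = -(-(1 + k)) by ring, hypergeometric_two,
    sum_choose_mul_pow n (-(1 + k)) (fun j => (-1) ^ j * y ^ j), momentPoly]
  · refine Finset.sum_congr rfl fun j hj => ?_
    have hj' : j ≤ n := Nat.lt_succ_iff.1 (Finset.mem_range.1 hj)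
    rw [choose_neg_eq, show (n : ℝ) + 1 + (-(1 + k) - j) = -(k + j - n) by ring, choose_neg_eq,
      Nat.cast_sub hj', show k + j - n + (n - j) - 1 = k - 1 by ring,
      show 1 + k + j - 1 = k + j by ring]
    have hs : ((-1 : ℝ) ^ j) * (-1) ^ j = 1 := by rw [← mul_pow]; simp
    linear_combination (Ring.choose (k + j) j * (-1) ^ (n - j) * Ring.choose (k - 1) (n - j) *
      y ^ j) * hs
  · intro s hs
    rw [← sum_range_choose_mul_extend hs, sub_eq_add_neg, add_comm, add_pow]
    refine Finset.sum_congr rfl fun r _ => ?_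
    rw [neg_pow, one_pow]
    ring

/-- A Pfaff transformation: `y^n (1 - y⁻¹)^s = (y-1)^s y^(n-s)` matches the Jacobi sum term by term.
-/
lemma pow_mul_hypergeometric_eq_momentPoly (n : ℕ) (k y : ℝ) (hy : y ≠ 0) :
    y ^ n * (((n : ℝ) + 1) * ordinaryHypergeometric (-(n : ℝ)) (1 - k) 2 (1 - y⁻¹)) =
      momentPoly n k y := by
  rw [show 1 - k = -(k - 1) by ring, hypergeometric_two, ← sum_jacobi_eq_momentPoly,
    Finset.mul_sum]
  refine Finset.sum_congr rfl fun s hs => ?_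
  have hs' : s ≤ n := Nat.lt_succ_iff.1 (Finset.mem_range.1 hs)
  have : (y - 1) ^ s * y ^ (n - s) = y ^ n * (1 - y⁻¹) ^ s := by
    rw [show y - 1 = y * (1 - y⁻¹) by field_simp, mul_pow]
    have h : y ^ n = y ^ (n - s) * y ^ s := by rw [← pow_add, Nat.sub_add_cancel hs']
    rw [h]
    ring
  rw [this]
  ring

/-- Here the terms match after reversing the order of summation. With `M = n + 1 + κ`, the identity
is `(M choose n)(n choose r) = (M choose r)(M-r choose n-r)`; the denominators do not vanish because
`r ≤ n < M`. -/
lemma pow_mul_hypergeometric_neg_eq_momentPoly (n κ : ℕ) (y : ℝ) (hy : y ≠ 0) :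
    y ^ n * (((n + 1 + κ).choose n : ℝ) *
      ordinaryHypergeometric (-(n : ℝ)) (-(κ : ℝ)) (-((n + 1 + κ : ℕ) : ℝ)) y⁻¹) =
      momentPoly n ((κ : ℝ) + 1) y := by
  rw [hypergeometric_neg_nat, momentPoly, Finset.mul_sum, Finset.mul_sum]
  conv_rhs => rw [← Finset.sum_range_reflect]
  refine Finset.sum_congr rfl fun r hr => ?_
  have hr' : r ≤ n := Nat.lt_succ_iff.1 (Finset.mem_range.1 hr)
  simp only [ascPochhammer_eval_neg_eq_choose, Nat.add_sub_cancel, Nat.sub_sub_self hr',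
    add_sub_cancel_right, Ring.choose_natCast]
  have h1 : ((κ : ℝ) + 1 + ((n - r : ℕ) : ℝ)) = ((n + 1 + κ - r : ℕ) : ℝ) := by
    rw [Nat.cast_sub hr', Nat.cast_sub (by omega)]; push_cast; ring
  have h2 : ((n + 1 + κ).choose n : ℝ) * n.choose r =
      (n + 1 + κ).choose r * (n + 1 + κ - r).choose (n - r) := by
    exact_mod_cast Nat.choose_mul hr'
  have h3 : y ^ n = y ^ (n - r) * y ^ r := by rw [← pow_add, Nat.sub_add_cancel hr']
  have hf : (r.factorial : ℝ) ≠ 0 := Nat.cast_ne_zero.2 r.factorial_ne_zero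
  have hc : ((n + 1 + κ).choose r : ℝ) ≠ 0 :=
    Nat.cast_ne_zero.2 (Nat.choose_pos (by omega)).ne'
  rw [h1, Ring.choose_natCast, h3, inv_pow]
  have hs : ((-1 : ℝ) ^ r) ≠ 0 := pow_ne_zero _ (by norm_num)
  field_simp
  linear_combination (κ.choose r : ℝ) * h2

/-- Under `p ↦ n - p`, upper negation interchanges the two binomial coefficients. This carries the
formula from `k` to `-k`. -/
lemma momentPoly_neg (n : ℕ) (k y : ℝ) (hy : y ≠ 0) :
    y ^ n * momentPoly n (-k) y⁻¹ = momentPoly n k y := by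
  rw [momentPoly, momentPoly, ← Finset.sum_range_reflect, Finset.mul_sum]
  refine Finset.sum_congr rfl fun p hp => ?_
  have hp' : p ≤ n := Nat.lt_succ_iff.1 (Finset.mem_range.1 hp)
  have h3 : y ^ n = y ^ (n - p) * y ^ p := by rw [← pow_add, Nat.sub_add_cancel hp']
  rw [Nat.add_sub_cancel, Nat.sub_sub_self hp', h3, inv_pow,
    show -k + ((n - p : ℕ) : ℝ) = -(k - ((n - p : ℕ) : ℝ)) by ring, choose_neg_eq,
    show -k - 1 = -(k + 1) by ring, choose_neg_eq,
    show k - ((n - p : ℕ) : ℝ) + ((n - p : ℕ) : ℝ) - 1 = k - 1 by ring,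
    show k + 1 + (p : ℝ) - 1 = k + p by ring]
  have hs : ((-1 : ℝ) ^ p) * (-1) ^ p = 1 := by rw [← mul_pow]; simp
  have hyp := mul_inv_cancel₀ (pow_ne_zero (n - p) hy)
  calc _ = ((-1 : ℝ) ^ p * (-1) ^ p) * (y ^ (n - p) * (y ^ (n - p))⁻¹) * (Ring.choose (k + p) p *
        ((-1) ^ (n - p) * Ring.choose (k - 1) (n - p)) * y ^ p) := by ring
    _ = _ := by rw [hs, hyp]; ring

/-! ### The weights of the exponentials -/

section Weights

lemma prod_Ioi_val {n : ℕ} (p : Fin (n + 1)) (g : ℕ → ℝ) :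
    ∏ j ∈ Finset.Ioi p, g j = ∏ u ∈ Finset.range (n - p), g (p + 1 + u) := by
  have h : (Finset.Ioi p).map Fin.valEmbedding = Finset.Ico ((p : ℕ) + 1) (n + 1) := by
    ext j
    simp only [Finset.mem_map, Finset.mem_Ioi, Fin.valEmbedding_apply, Finset.mem_Ico]
    refine ⟨?_, fun hj => ⟨⟨j, hj.2⟩, Fin.lt_def.2 (by simpa using hj.1), rfl⟩⟩
    rintro ⟨a, ha, rfl⟩
    exact ⟨Fin.lt_def.1 ha, a.2⟩
  calc _ = ∏ j ∈ (Finset.Ioi p).map Fin.valEmbedding, g j := (Finset.prod_map _ _ _).symm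
    _ = _ := by rw [h, Finset.prod_Ico_eq_prod_range, Nat.add_sub_add_right]

lemma prod_Iio_val {n : ℕ} (p : Fin (n + 1)) (g : ℕ → ℝ) :
    ∏ j ∈ Finset.Iio p, g j = ∏ u ∈ Finset.range p, g u := by
  rw [← Nat.Iio_eq_range, ← Fin.map_valEmbedding_Iio, Finset.prod_map]
  rfl

lemma prod_range_sub_add_div (k : ℝ) (p : ℕ) :
    ∏ i ∈ Finset.range p, ((p : ℝ) - i + k) / ((p : ℝ) - i) = Ring.choose (k + p) p := by
  rw [choose_eq_prod, Finset.prod_div_distrib, Finset.prod_div_distrib]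
  congr 1
  · exact Finset.prod_congr rfl fun i _ => by ring
  · rw [← Finset.prod_range_reflect]
    refine Finset.prod_congr rfl fun i hi => ?_
    have := Finset.mem_range.1 hi
    rw [Nat.cast_sub (by omega), Nat.cast_sub (by omega)]
    push_cast
    ring

lemma prod_range_sub_div (k : ℝ) (r : ℕ) :
    ∏ u ∈ Finset.range r, ((u : ℝ) + 1 - k) / ((u : ℝ) + 1) =
      (-1) ^ r * Ring.choose (k - 1) r := by
  rw [choose_eq_prod]
  nth_rewrite 2 [← Finset.card_range r]
  rw [← Finset.prod_const, ← Finset.prod_mul_distrib]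
  exact Finset.prod_congr rfl fun u _ => by ring

/-- Only pairs containing `p` contribute: indices below `p` give the first binomial coefficient,
indices above it the second, with its sign. -/
lemma prod_shiftedRho (n k : ℕ) (p : Fin (n + 1)) :
    ∏ i : Fin (n + 1), ∏ j ∈ Finset.Ioi i,
      (shiftedRho (n + 1) k p j - shiftedRho (n + 1) k p i) / (rho (n + 1) j - rho (n + 1) i) =
      Ring.choose ((k : ℝ) + (p : ℕ)) p *
        ((-1) ^ (n - (p : ℕ)) * Ring.choose ((k : ℝ) - 1) (n - p)) := by
  have hrho : ∀ i j : Fin (n + 1), rho (n + 1) j - rho (n + 1) i = (j : ℕ) - (i : ℕ) := by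
    intro i j; simp [rho]
  have hne : ∀ i j : Fin (n + 1), i < j → ((j : ℕ) : ℝ) - (i : ℕ) ≠ 0 := by
    intro i j hij
    rw [sub_ne_zero]
    exact Nat.cast_injective.ne (Fin.lt_def.1 hij).ne'
  have hshift : ∀ i j : Fin (n + 1), shiftedRho (n + 1) k p j - shiftedRho (n + 1) k p i =
      (j : ℕ) - (i : ℕ) + (if j = p then (k : ℝ) else 0) - (if i = p then (k : ℝ) else 0) := by
    intro i j
    rw [← hrho, shiftedRho, shiftedRho]
    ring
  have hrow : ∀ i : Fin (n + 1), ∏ j ∈ Finset.Ioi i,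
      (shiftedRho (n + 1) k p j - shiftedRho (n + 1) k p i) / (rho (n + 1) j - rho (n + 1) i) =
      (if i < p then (((p : ℕ) : ℝ) - (i : ℕ) + k) / (((p : ℕ) : ℝ) - (i : ℕ)) else 1) *
      (if i = p then ∏ j ∈ Finset.Ioi p,
        (((j : ℕ) : ℝ) - (p : ℕ) - k) / (((j : ℕ) : ℝ) - (p : ℕ)) else 1) := by
    intro i
    simp only [hshift, hrho]
    by_cases hip : i = p
    · subst hip
      rw [if_neg (lt_irrefl _), one_mul]
      simp only [if_true]
      refine Finset.prod_congr rfl fun j hj => ?_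
      rw [if_neg (Finset.mem_Ioi.1 hj).ne', add_zero]
    · simp only [if_neg hip, mul_one, sub_zero]
      have h1 : ∀ j ∈ Finset.Ioi i, j ≠ p →
          (((j : ℕ) : ℝ) - (i : ℕ) + (if j = p then (k : ℝ) else 0)) /
            (((j : ℕ) : ℝ) - (i : ℕ)) = 1 := by
        intro j hj hjp
        rw [if_neg hjp, add_zero, div_self (hne i j (Finset.mem_Ioi.1 hj))]
      split_ifs with hlt
      · rw [Finset.prod_eq_single_of_mem p (Finset.mem_Ioi.2 hlt) h1, if_pos rfl]
      · refine Finset.prod_eq_one fun j hj => h1 j hj ?_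
        rintro rfl
        exact hlt (Finset.mem_Ioi.1 hj)
  rw [Finset.prod_congr rfl fun i _ => hrow i, Finset.prod_mul_distrib, Finset.prod_ite_eq',
    if_pos (Finset.mem_univ _), ← Finset.prod_filter, Finset.filter_gt_eq_Iio,
    prod_Iio_val p (fun i => (((p : ℕ) : ℝ) - i + k) / (((p : ℕ) : ℝ) - i)),
    prod_Ioi_val p (fun j => ((j : ℝ) - (p : ℕ) - k) / ((j : ℝ) - (p : ℕ))),
    prod_range_sub_add_div, ← prod_range_sub_div]
  congr 1
  refine Finset.prod_congr rfl fun u _ => ?_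
  push_cast
  congr 1 <;> ring

end Weights

/-! ### Evolution of the moments -/

section Evolution

variable {N : ℕ}

lemma integrable_of_continuous_of_mem_cube {ν : Measure (Fin N → ℝ)} [IsFiniteMeasure ν]
    (hν : ∀ᵐ x ∂ν, x ∈ angleCube N) {f : (Fin N → ℝ) → ℂ} (hf : Continuous f) :
    Integrable f ν := by
  obtain ⟨C, hC⟩ := (isCompact_univ_pi fun _ : Fin N =>
    isCompact_Icc (a := -Real.pi) (b := Real.pi)).exists_bound_of_continuousOn hf.continuousOn
  refine Integrable.of_bound hf.aestronglyMeasurable C ?_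
  filter_upwards [hν] with x hx using hC x fun j _ => Set.Ioc_subset_Icc_self (hx j)

lemma densityMoment_eq {ν : Measure (Fin N → ℝ)} [IsFiniteMeasure ν]
    (hν : ∀ᵐ x ∂ν, x ∈ angleCube N) (k : ℤ) : densityMoment ν k =
      (1 / (N : ℂ)) * ∑ l, ∫ x, Complex.exp (-Complex.I * (k : ℂ) * (x l : ℂ)) ∂ν := by
  have hcont : Continuous fun y : ℝ => Complex.exp (-Complex.I * (k : ℂ) * (y : ℂ)) := by fun_prop
  have hmeas : StronglyMeasurable ((Set.Ioc (-Real.pi) Real.pi).indicator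
      fun y : ℝ => Complex.exp (-Complex.I * (k : ℂ) * (y : ℂ))) :=
    hcont.stronglyMeasurable.indicator measurableSet_Ioc
  have hnorm : ∀ y : ℝ, ‖Complex.exp (-Complex.I * (k : ℂ) * (y : ℂ))‖ = 1 := by
    intro y
    rw [show -Complex.I * (k : ℂ) * (y : ℂ) = ((-k * y : ℝ) : ℂ) * Complex.I by push_cast; ring,
      Complex.norm_exp_ofReal_mul_I]
  rw [densityMoment, eigenvalueDensity, ← integral_indicator measurableSet_Ioc,
    integral_finsetSum_measure]
  · congr 1
    refine Finset.sum_congr rfl fun l _ => ?_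
    rw [integral_map (measurable_pi_apply l).aemeasurable hmeas.aestronglyMeasurable]
    refine integral_congr_ae ?_
    filter_upwards [hν] with x hx
    rw [Set.indicator_of_mem (hx l)]
  · intro l _
    have := Measure.isFiniteMeasure_map ν fun x : Fin N → ℝ => x l
    refine Integrable.of_bound hmeas.aestronglyMeasurable 1 (Eventually.of_forall fun y => ?_)
    exact (norm_indicator_le_norm_self _ _).trans (hnorm y).le

/-- The eigenvalue density is a positive measure, so its Fourier coefficients at `k` and `-k` are
conjugate. -/
lemma densityMoment_neg {ν : Measure (Fin N → ℝ)} [IsFiniteMeasure ν]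
    (hν : ∀ᵐ x ∂ν, x ∈ angleCube N) (k : ℤ) :
    densityMoment ν (-k) = starRingEnd ℂ (densityMoment ν k) := by
  rw [densityMoment_eq hν, densityMoment_eq hν, map_mul, map_sum]
  congr 1
  · simp
  · refine Finset.sum_congr rfl fun l _ => ?_
    rw [← integral_conj]
    congr 1
    funext x
    rw [← Complex.exp_conj]
    simp

lemma densityMoment_natCast {ν : Measure (Fin N → ℝ)} [IsFiniteMeasure ν]
    (hν : ∀ᵐ x ∂ν, x ∈ angleCube N) (k : ℕ) : densityMoment ν k =
      (1 / (N : ℂ)) * ∑ p, ∫ x, companionDiag k p x ∂ν := by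
  rw [densityMoment_eq hν, ← integral_finsetSum, ← integral_finsetSum]
  · congr 2
    funext x
    rw [sum_companionDiag]
    refine Finset.sum_congr rfl fun l _ => ?_
    rw [circlePoint, ← Complex.exp_nat_mul]
    congr 1
    push_cast
    ring
  · exact fun p _ => integrable_of_continuous_of_mem_cube hν
      (isTestFunction_companionDiag k p).smooth.continuous
  · exact fun l _ => integrable_of_continuous_of_mem_cube hν (by fun_prop)

/-- The expectation of an eigenfunction of the adjoint Fokker-Planck operator evolves
exponentially. -/
lemma IsDysonBM.integral_eq {x₀ : Fin N → ℝ} {μ : ℝ → Measure (Fin N → ℝ)}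
    (hμ : IsDysonBM N x₀ μ) {F : (Fin N → ℝ) → ℂ} (hF : IsTestFunction F) (c : ℂ)
    (hc : ∀ᵐ x, adjointFP N F x = c * F x) (t : ℝ) (ht : 0 ≤ t) :
    ∫ x, F x ∂(μ t) = Complex.exp (c / N * t) * F x₀ := by
  rcases ht.eq_or_lt with rfl | ht
  · rw [hμ.init, integral_dirac]
    simp
  set f : ℝ → ℂ := fun s => ∫ x, F x ∂(μ s) with hf
  have hd : ∀ s, 0 < s → HasDerivAt f (c / N * f s) s := by
    intro s hs
    have h := hμ.weak_eq F hF s hs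
    -- The eigenvalue equation is known only Lebesgue-almost everywhere; absolute continuity
    -- transfers it to the law at time `s`.
    rw [integral_congr_ae ((hμ.hasPDF s hs).ae_le hc), integral_const_mul] at h
    convert h using 1
    rw [hf]
    ring
  have he : ∀ s : ℝ, HasDerivAt (fun s : ℝ => Complex.exp (-(c / N) * s))
      (Complex.exp (-(c / N) * s) * -(c / N)) s := by
    intro s
    have h1 : HasDerivAt (fun s : ℝ => -(c / N) * (s : ℂ)) (-(c / N)) s := by
      simpa using (hasDerivAt_id s).ofReal_comp.const_mul (-(c / N))
    exact h1.cexp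
  -- Integrating factor: the product is constant on `(0, ∞)`, and its limit at `0⁺` identifies the
  -- constant.
  have hg : ∀ s, 0 < s → HasDerivAt (fun s : ℝ => Complex.exp (-(c / N) * s) * f s) 0 s := by
    intro s hs
    have h := (he s).fun_mul (hd s hs)
    rwa [show ∀ a b d : ℂ, a * -b * d + a * (b * d) = 0 from fun a b d => by ring] at h
  have hconst : ∀ s : ℝ, 0 < s →
      Complex.exp (-(c / N) * s) * f s = Complex.exp (-(c / N) * t) * f t := by
    intro s hs
    exact isOpen_Ioi.is_const_of_deriv_eq_zero (s := Set.Ioi (0 : ℝ)) isPreconnected_Ioi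
      (fun s hs => (hg s hs).differentiableAt.differentiableWithinAt)
      (fun s hs => (hg s hs).deriv) hs ht
  have hlim : Tendsto (fun s : ℝ => Complex.exp (-(c / N) * s) * f s) (𝓝[>] 0) (𝓝 (F x₀)) := by
    have h1 : Tendsto (fun s : ℝ => Complex.exp (-(c / N) * s)) (𝓝[>] 0) (𝓝 1) := by
      have := (he 0).continuousAt.tendsto.mono_left (nhdsWithin_le_nhds (s := Set.Ioi 0))
      simpa using this
    simpa using h1.mul (hμ.init_limit F hF)
  have heq : Complex.exp (-(c / N) * t) * f t = F x₀ :=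
    tendsto_nhds_unique (l := 𝓝[>] (0 : ℝ)) (tendsto_const_nhds.congr'
      (eventually_nhdsWithin_of_forall fun s hs => (hconst s hs).symm)) hlim
  rw [← heq, ← mul_assoc, ← Complex.exp_add]
  simp [hf]

lemma densityMoment_natCast_eq_momentPoly (n : ℕ) {μ : ℝ → Measure (Fin (n + 1) → ℝ)}
    (hμ : IsDysonBMFromIdentity (n + 1) μ) (t q : ℝ) (ht : 0 ≤ t)
    (hq : q = Real.exp (-t / (2 * ((n : ℝ) + 1)))) (k : ℕ) : densityMoment (μ t) k =
      ((1 / ((n : ℝ) + 1) * q ^ ((k : ℤ) ^ 2 - k * n) * momentPoly n k (q ^ (2 * (k : ℤ))) : ℝ)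
        : ℂ) := by
  have := IsDysonBM.isProb hμ t ht
  have hq0 : q ≠ 0 := by rw [hq]; exact Real.exp_ne_zero _
  have hn : ((n : ℝ) + 1) ≠ 0 := by positivity
  rw [densityMoment_natCast (hμ.mem_cube t ht), mul_assoc, Complex.ofReal_mul]
  congr 1
  · push_cast; rfl
  rw [momentPoly, Finset.sum_range, Finset.mul_sum, Complex.ofReal_sum]
  refine Finset.sum_congr rfl fun p _ => ?_
  rw [IsDysonBM.integral_eq hμ (isTestFunction_companionDiag k p) _
    (ae_alternant_rho_ne_zero.mono (adjointFP_companionDiag k p)) t ht, companionDiag_zero,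
    prod_shiftedRho]
  -- Since `rho (n+1) p = p - n/2`, the decay rate of the `p`-th term corresponds to `q^(k² - kn +
  -- 2kp)`.
  have h : q ^ ((k : ℤ) ^ 2 - k * n) * (q ^ (2 * (k : ℤ))) ^ (p : ℕ) =
      Real.exp (-(k ^ 2 + 2 * k * rho (n + 1) p) / 2 / ((n + 1 : ℕ) : ℝ) * t) := by
    rw [← zpow_natCast, ← zpow_mul, ← zpow_add₀ hq0, hq, ← Real.rpow_intCast, ← Real.exp_mul, rho]
    congr 1
    push_cast
    field_simp
    ring
  have h2 : ∀ w : ℝ, q ^ ((k : ℤ) ^ 2 - k * n) * (w * (q ^ (2 * (k : ℤ))) ^ (p : ℕ)) =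
      Real.exp (-(k ^ 2 + 2 * k * rho (n + 1) p) / 2 / ((n + 1 : ℕ) : ℝ) * t) * w := fun w => by
    rw [← h]; ring
  rw [h2]
  simp only [Complex.ofReal_mul (Real.exp _), Complex.ofReal_exp]
  congr 2
  push_cast
  rfl

lemma densityMoment_eq_momentPoly (n : ℕ) {μ : ℝ → Measure (Fin (n + 1) → ℝ)}
    (hμ : IsDysonBMFromIdentity (n + 1) μ) (t q : ℝ) (ht : 0 ≤ t)
    (hq : q = Real.exp (-t / (2 * ((n : ℝ) + 1)))) (k : ℤ) : densityMoment (μ t) k =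
      ((1 / ((n : ℝ) + 1) * q ^ (k ^ 2 - k * n) * momentPoly n k (q ^ (2 * k)) : ℝ) : ℂ) := by
  have := IsDysonBM.isProb hμ t ht
  have hq0 : q ≠ 0 := by rw [hq]; exact Real.exp_ne_zero _
  obtain ⟨k, rfl | rfl⟩ := k.eq_nat_or_neg
  · exact densityMoment_natCast_eq_momentPoly n hμ t q ht hq k
  · rw [densityMoment_neg (hμ.mem_cube t ht), densityMoment_natCast_eq_momentPoly n hμ t q ht hq k,
      Complex.conj_ofReal]
    have h := momentPoly_neg n ((k : ℕ) : ℝ) (q ^ (2 * (k : ℤ))) (zpow_ne_zero _ hq0)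
    -- The extra `q^(2kn)` is the factor `y^n` of `momentPoly_neg` at `y = q^(2k)`.
    have hexp : q ^ ((-(k : ℤ)) ^ 2 - -(k : ℤ) * n) =
        q ^ ((k : ℤ) ^ 2 - k * n) * (q ^ (2 * (k : ℤ))) ^ n := by
      rw [← zpow_natCast, ← zpow_mul, ← zpow_add₀ hq0]
      congr 1
      ring
    rw [← h, hexp, mul_neg, zpow_neg, Int.cast_neg, Int.cast_natCast]
    congr 1
    ring

end Evolution

end DysonU

/-! ### The closed forms of the moments -/

theorem proposition1p1 (N : ℕ) (hN : 1 ≤ N) (μ : ℝ → MeasureTheory.Measure (Fin N → ℝ))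
    (hμ : DysonU.IsDysonBMFromIdentity N μ) (t q : ℝ) (ht : 0 ≤ t)
    (hq : q = Real.exp (-t / (2 * (N : ℝ)))) :
    (∀ k : ℤ,
      DysonU.densityMoment (μ t) k =
        ((q ^ (k * ((N : ℤ) + k - 1)) *
          ordinaryHypergeometric (1 - (N : ℝ)) (1 - (k : ℝ)) (2 : ℝ) (1 - q ^ (-2 * k)) : ℝ) : ℂ) ∧
      DysonU.densityMoment (μ t) k =
        ((q ^ (k ^ 2 - k * ((N : ℤ) - 1)) *
          ordinaryHypergeometric (1 - (N : ℝ)) (1 + (k : ℝ)) (2 : ℝ) (1 - q ^ (2 * k)) : ℝ) : ℂ) ∧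
      DysonU.densityMoment (μ t) k =
        ((1 / (N : ℝ) * q ^ (k ^ 2 - k * ((N : ℤ) - 1)) *
          DysonU.jacobiP (N - 1) 1 ((k : ℝ) - (N : ℝ)) (2 * q ^ (2 * k) - 1) : ℝ) : ℂ) ∧
      DysonU.densityMoment (μ t) k =
        (((-1) ^ (N - 1) / (N : ℝ) * q ^ (k ^ 2 - k * ((N : ℤ) - 1)) *
          DysonU.jacobiP (N - 1) ((k : ℝ) - (N : ℝ)) 1 (1 - 2 * q ^ (2 * k)) : ℝ) : ℂ)) ∧
    (∀ k : ℕ, 1 ≤ k →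
      DysonU.densityMoment (μ t) (k : ℤ) =
        ((q ^ (k ^ 2 + k * (N - 1)) *
          ((Nat.factorial (N - 1 + k) : ℝ) / ((Nat.factorial k : ℝ) * (Nat.factorial N : ℝ))) *
          ordinaryHypergeometric (1 - (N : ℝ)) (1 - (k : ℝ)) (-((k : ℝ) - 1 + (N : ℝ)))
            (q ^ (-2 * (k : ℤ))) : ℝ) : ℂ)) := by
  -- This removes the truncated subtraction `N - 1` and makes `1 - N = -n` visibly a nonpositive
  -- integer.
  obtain ⟨n, rfl⟩ : ∃ n, N = n + 1 := ⟨N - 1, by omega⟩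
  have hq' : q = Real.exp (-t / (2 * ((n : ℝ) + 1))) := by rw [hq]; push_cast; rfl
  have hq0 : q ≠ 0 := by rw [hq]; exact Real.exp_ne_zero _
  have hn : ((n : ℝ) + 1) ≠ 0 := by positivity
  have h1 : 1 - ((n + 1 : ℕ) : ℝ) = -(n : ℝ) := by push_cast; ring
  have hy : ∀ k : ℤ, q ^ (2 * k) ≠ 0 := fun k => zpow_ne_zero _ hq0
  have hinv : ∀ k : ℤ, q ^ (-2 * k) = (q ^ (2 * k))⁻¹ := fun k => by
    rw [← zpow_neg, neg_mul]
  have hexp : ∀ k : ℤ, q ^ (k ^ 2 + k * n) = q ^ (k ^ 2 - k * n) * (q ^ (2 * k)) ^ n := fun k => by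
    rw [← zpow_natCast, ← zpow_mul, ← zpow_add₀ hq0]
    congr 1
    ring
  have hN1 : ((n + 1 : ℕ) : ℤ) - 1 = n := by push_cast; ring
  refine ⟨fun k => ?_, fun k hk => ?_⟩
  · rw [DysonU.densityMoment_eq_momentPoly n hμ t q ht hq' k, h1, hN1, Nat.add_sub_cancel]
    refine ⟨congrArg _ ?_, congrArg _ ?_, congrArg _ ?_, congrArg _ ?_⟩
    · rw [hinv, show k * (((n + 1 : ℕ) : ℤ) + k - 1) = k ^ 2 + k * n by push_cast; ring, hexp,
        ← DysonU.pow_mul_hypergeometric_eq_momentPoly n k _ (hy k)]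
      field_simp
    · rw [← DysonU.hypergeometric_eq_momentPoly]
      field_simp
    · rw [Nat.cast_succ, DysonU.jacobiP_eq_momentPoly]
    · rw [Nat.cast_succ, show 1 - 2 * q ^ (2 * k) = -(2 * q ^ (2 * k) - 1) by ring,
        DysonU.jacobiP_neg, DysonU.jacobiP_eq_momentPoly]
      have hs : ((-1 : ℝ) ^ n) * (-1) ^ n = 1 := by rw [← mul_pow]; simp
      linear_combination (-(1 / ((n : ℝ) + 1) * q ^ (k ^ 2 - k * n) *
        DysonU.momentPoly n k (q ^ (2 * k)))) * hs
  · obtain ⟨κ, rfl⟩ : ∃ κ, k = κ + 1 := ⟨k - 1, by omega⟩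
    rw [DysonU.densityMoment_eq_momentPoly n hμ t q ht hq' _, h1, hinv]
    refine congrArg _ ?_
    have hpow : q ^ ((κ + 1) ^ 2 + (κ + 1) * (n + 1 - 1)) =
        q ^ (((κ + 1 : ℕ) : ℤ) ^ 2 + ((κ + 1 : ℕ) : ℤ) * n) := by
      rw [← zpow_natCast, Nat.add_sub_cancel]
      push_cast
      rfl
    -- With `k = κ + 1`, the prefactor `(N-1+k)! / (k! N!)` is this binomial coefficient divided by
    -- `N`.
    have hch : ((n + 1 + κ).choose n : ℝ) =
        (n + 1) * ((n + 1 + κ).factorial / ((κ + 1).factorial * (n + 1).factorial)) := by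
      rw [Nat.cast_choose ℝ (by omega : n ≤ n + 1 + κ), show n + 1 + κ - n = κ + 1 by omega,
        Nat.factorial_succ n]
      have := Nat.cast_ne_zero (R := ℝ).2 n.factorial_ne_zero
      have := Nat.cast_ne_zero (R := ℝ).2 (κ + 1).factorial_ne_zero
      push_cast
      field_simp
    have h := DysonU.pow_mul_hypergeometric_neg_eq_momentPoly n κ _ (hy ((κ + 1 : ℕ) : ℤ))
    rw [hch] at h
    rw [hpow, hexp, show 1 - ((κ + 1 : ℕ) : ℝ) = -(κ : ℝ) by push_cast; ring,
      show -(((κ + 1 : ℕ) : ℝ) - 1 + ((n + 1 : ℕ) : ℝ)) = -((n + 1 + κ : ℕ) : ℝ) by push_cast; ring,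
      show n + 1 - 1 + (κ + 1) = n + 1 + κ by omega,
      show (((κ + 1 : ℕ) : ℤ) : ℝ) = (κ : ℝ) + 1 by push_cast; ring, ← h]
    field_simp
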